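/- Conventions. A configuration of a prime alternating knot is a reduced alternating diagram, on the sphere, of a knot (one component, at least one crossing), which is prime: no disc whose boundary meets the diagram transversally in exactly two points, away from the crossings, has crossings both inside and outside it. An $n$-tangle is the part of the diagram in a disc whose boundary meets the diagram transversally in $n$ points, away from the crossings; it is identified with its set of crossings, and the $n$ arcs that meet the boundary of the disc are its incident arcs. A group is a maximal set of crossings any two of which are linked by a chain of two-sided faces; a $k$-group is a group with $k$ crossings, and a $1$-group is called a loner. Let $G$ be a group that is not the whole diagram. Its four incident arcs fall into two opposite ends, each consisting of two neighbouring arcs at one crossing (for a loner there are two ways to choose the ends, and both are allowed). Fix such a choice and one of the two ends. Consider the empty set together with all 4-tangles $X$, disjoint from $G$, for which both arcs of this end are among the four incident arcs of $X$; these are the tangles across which $G$ can be flyped from this end, and they form a chain under inclusion. The sets $Y\setminus X$, for consecutive members $X\subsetneq Y$ of this chain, are called min-tangles in the orbit of $G$. The configuration is a full group configuration if for no group $G$ there are such an $X$ (possibly empty) and a crossing $d\notin X$ for which $X\cup\{d\}$ is again one of these tangles, that is, if no crossing can be flyped so as to enlarge a group. A drots 2-group is a 2-group $G_D$ (positive or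 negative) that is a min-tangle in the orbit of some group $G$; such a group $G$ is called the orbiter group of $G_D$. An OTS 6-tangle is a 6-tangle that consists of exactly three crossings, which are the corners of a three-sided face. A loner is adjacent to $G_D$ if two neighbouring arcs at its crossing both lead directly to crossings of $G_D$. Proposition. Let $C(K)$ be a full group configuration of a prime alternating knot $K$, and let $G_D$ be a drots 2-group (positive or negative) such that some OTS 6-tangle in $C(K)$ contains a crossing of $G_D$. Then the orbiter group $G$ of $G_D$ is a loner, and it is adjacent to $G_D$. -/

import Mathlib

/-- A link diagram on a closed oriented surface with set of crossings `V`. The four half-arcs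
("darts") at a crossing `v` are `(v, 0), (v, 1), (v, 2), (v, 3)`, in counterclockwise order; the
strand through `(v, 0), (v, 2)` passes over the strand through `(v, 1), (v, 3)`.
`opp` sends a dart to the other end of the arc on which it lies. -/
structure LinkDiagram (V : Type*) where
  opp : Equiv.Perm (V × ZMod 4)
  opp_opp : ∀ d, opp (opp d) = d
  opp_ne : ∀ d, opp d ≠ d

namespace LinkDiagram

/-- Rotation of all darts by `k` quarter turns counterclockwise about their crossings. -/
def turn {V : Type*} (k : ZMod 4) : Equiv.Perm (V × ZMod 4) :=
  Equiv.prodCongr (Equiv.refl V) (Equiv.addRight k)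

section Basic

variable {V : Type*} (D : LinkDiagram V)

/-- Walk along an arc and go straight ahead at the crossing that is reached. -/
def straight : Equiv.Perm (V × ZMod 4) := D.opp.trans (turn 2)

/-- Walk along an arc and turn left at the crossing that is reached; the cycles of this
permutation are the faces of the diagram. -/
def face : Equiv.Perm (V × ZMod 4) := D.opp.trans (turn (-1))

/-- There is at least one crossing and exactly one component: any two darts lie on one closed
strand, traversed in the same or in opposite directions. -/
def IsKnot : Prop :=
  Nonempty V ∧ ∀ a b, D.straight.SameCycle a b ∨ D.straight.SameCycle a (D.opp b)

/-- Euler's formula `#V - #E + #F = 2` with `#E = 2 * #V`: for a connected diagram (in particular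
for a knot) the surface on which the diagram is drawn is the sphere. -/
def IsSpherical : Prop :=
  Nat.card (Quotient (Equiv.Perm.SameCycle.setoid D.face)) = Nat.card V + 2

/-- Every arc runs from an overpass to an underpass. -/
def IsAlternating : Prop := ∀ d, Even (D.opp d).2 ↔ ¬ Even d.2

/-- No crossing is nugatory: opposite corners at a crossing belong to different faces. -/
def IsReduced : Prop := ∀ d, ¬ D.face.SameCycle d (turn 2 d)

/-- The distinct crossings `u` and `v` are the two corners of a face with two sides. -/
def Bigon (u v : V) : Prop :=
  u ≠ v ∧ ∃ i j, D.opp (u, i) = (v, j) ∧ D.opp (u, i + 1) = (v, j - 1)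

/-- A group: a maximal set of crossings in which any two are linked by a chain of two-sided
faces (a maximal row of half twists, or a single crossing that is in no such row). -/
def IsGroup (G : Finset V) : Prop :=
  ∃ v, ∀ w, w ∈ G ↔ Relation.EqvGen D.Bigon v w

/-- A loner is a group that consists of a single crossing. -/
def IsLoner (G : Finset V) : Prop := D.IsGroup G ∧ G.card = 1

end Basic

section Tangles

variable {V : Type*} [Fintype V] [DecidableEq V] (D : LinkDiagram V)

/-- The darts at crossings of `T` on the arcs that leave `T`; the arcs incident to the tangle
with set of crossings `T` correspond to them. -/
def boundary (T : Finset V) : Finset (V × ZMod 4) :=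
  Finset.univ.filter fun d => d.1 ∈ T ∧ (D.opp d).1 ∉ T

/-- Prime: there is no 2-tangle with crossings both inside and outside it. -/
def IsPrime : Prop := ∀ T : Finset V, (D.boundary T).card ≠ 2

/-- A configuration of a prime alternating knot. -/
structure IsPrimeAlternatingKnot : Prop where
  knot : D.IsKnot
  spherical : D.IsSpherical
  alternating : D.IsAlternating
  reduced : D.IsReduced
  prime : D.IsPrime

/-- `p` stands for the pair of neighbouring darts `p`, `turn 1 p` at one crossing, and these are
two of the incident arcs of `G`. -/
def IsEnd (G : Finset V) (p : V × ZMod 4) : Prop :=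
  p ∈ D.boundary G ∧ turn 1 p ∈ D.boundary G

/-- A direction in which `G` can be flyped: the four arcs incident to `G` are divided into
two opposite ends `p, turn 1 p` and `q, turn 1 q`. A group of two or more crossings that is not
the whole diagram has one such division (up to exchanging the ends), a loner has two. -/
def IsAxis (G : Finset V) (p q : V × ZMod 4) : Prop :=
  (D.boundary G).card = 4 ∧ D.boundary G = {p, turn 1 p, q, turn 1 q}

/-- `X` is a tangle across which `G` can be flyped starting from its end `p`: either `X` is empty
(`G` stays where it is), or `X` is a 4-tangle outside `G` which has the two arcs at the end `p` of
`G` among its four incident arcs. The other two incident arcs of `X` are the position to which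
`G` is moved by the flype. -/
def IsSegment (G : Finset V) (p : V × ZMod 4) (X : Finset V) : Prop :=
  X = ∅ ∨ (Disjoint X G ∧ (D.boundary X).card = 4 ∧
    D.opp p ∈ D.boundary X ∧ D.opp (turn 1 p) ∈ D.boundary X)

/-- `T` is a min-tangle in the orbit of `G`: the tangle between two consecutive positions of
`G` along one of its directions. -/
def IsMinTangle (G T : Finset V) : Prop :=
  ∃ p q, D.IsAxis G p q ∧ ∃ X Y, D.IsSegment G p X ∧ D.IsSegment G p Y ∧ X ⊂ Y ∧
    (∀ Z, D.IsSegment G p Z → X ⊆ Z → Z ⊆ Y → Z = X ∨ Z = Y) ∧ T = Y \ X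

/-- The group `G` is full: there is no further crossing `d` which could be flyped across a tangle
`X` between `G` and `d` to a place next to an end of `G`, where it would enlarge the group. -/
def IsFullGroup (G : Finset V) : Prop :=
  D.IsGroup G ∧ ∀ p q, D.IsAxis G p q → ∀ X d, d ∉ X → D.IsSegment G p X →
    ¬ D.IsSegment G p (insert d X)

/-- All groups are full. -/
def IsFullGroupConfiguration : Prop := ∀ G, D.IsGroup G → D.IsFullGroup G

/-- The group `G` is an orbiter of `T`: `T` is a min-tangle in the orbit of `G`. -/
def IsOrbiter (G T : Finset V) : Prop := D.IsGroup G ∧ D.IsMinTangle G T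

/-- A drots 2-group, of either sign: a group of two crossings that is a min-tangle in the orbit
of some group. -/
def IsDrotsTwoGroup (H : Finset V) : Prop :=
  D.IsGroup H ∧ H.card = 2 ∧ ∃ G, D.IsOrbiter G H

/-- An OTS 6-tangle: three crossings that are the corners of a three-sided face, with six incident
arcs (three strands, any two of which cross exactly once in the tangle). -/
def IsOTSTangle (T : Finset V) : Prop :=
  T.card = 3 ∧ (D.boundary T).card = 6 ∧
    ∃ d, D.face (D.face (D.face d)) = d ∧ T = {d.1, (D.face d).1, (D.face (D.face d)).1}

/-- `G` is in a position adjacent to `H`: both arcs at one end of `G` lead directly to `H`. -/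
def IsAdjacent (G H : Finset V) : Prop :=
  ∃ p, D.IsEnd G p ∧ (D.opp p).1 ∈ H ∧ (D.opp (turn 1 p)).1 ∈ H

end Tangles

end LinkDiagram

namespace LinkDiagram

/-! ### Darts, triangular corners and two-sided faces. -/

section Darts

variable {V : Type*} (D : LinkDiagram V)

/-! Write the drots 2-group as `Y \ X = {a, b}`, where `X ⊂ Y` are consecutive tangles across which
`G` is flyped from its end `p`. Two of the incident arcs of `Y` lead to the end `p`; call the other
two far. The bigon between `a` and `b` leaves two outer arcs at each of these crossings. By
minimality one of them is far and the other is near, that is, it leads to the end `p` (if `X` is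
empty) or into `X`: if both outer arcs at a crossing `v` were near, `insert v X` would be a tangle
strictly between `X` and `Y` (`not_both_near`, `far_iff_of_bigon`).

Two crossings of an OTS tangle are joined by a single arc (`dart_unique`), so an OTS tangle
containing `a` misses `b`. The sides of its triangle at `a` are therefore the near and the far arc
there, and the third side `γ` joins their other endpoints. Counting incident arcs, with at least
four for every proper nonempty tangle by primeness and connectedness, restricts where `γ` can run.
Either it forces the two ends of `G` to lie at one crossing, so that `G` is a loner with an end
leading straight to `{a, b}`, or it gives a contradiction (`IsFlypeStep.isLoner_and_isAdjacent`). -/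

@[simp] theorem turn_fst (k : ZMod 4) (d : V × ZMod 4) : (turn k d).1 = d.1 := rfl

@[simp] theorem turn_snd (k : ZMod 4) (d : V × ZMod 4) : (turn k d).2 = d.2 + k := rfl

theorem turn_one_ne (d : V × ZMod 4) : turn 1 d ≠ d := fun h => by
  have h2 : d.2 + 1 = d.2 := congrArg Prod.snd h
  revert h2; generalize d.2 = k; revert k; decide

theorem turn_one_face (d : V × ZMod 4) : turn 1 (D.face d) = D.opp d := by
  ext <;> simp [face]

@[simp] theorem face_fst (d : V × ZMod 4) : (D.face d).1 = (D.opp d).1 := rfl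

theorem opp_turn_one_of_face_three {D : LinkDiagram V} {d : V × ZMod 4}
    (hd : D.face (D.face (D.face d)) = d) :
    D.opp (turn 1 d) = D.face (D.face d) := by
  have h := D.turn_one_face (D.face (D.face d))
  rw [hd] at h
  rw [h, D.opp_opp]

theorem dart_cases {d e : V × ZMod 4} (h : e.1 = d.1) :
    e = d ∨ e = turn 1 d ∨ e = turn 2 d ∨ e = turn 3 d := by
  have key : ∀ k l : ZMod 4, k = l ∨ k = l + 1 ∨ k = l + 2 ∨ k = l + 3 := by decide
  rcases key e.2 d.2 with hk | hk | hk | hk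
  · exact .inl (Prod.ext h hk)
  · exact .inr (.inl (Prod.ext h hk))
  · exact .inr (.inr (.inl (Prod.ext h hk)))
  · exact .inr (.inr (.inr (Prod.ext h hk)))

/-- The outer corners of a two-sided face. -/
theorem Bigon.exists_outer {D : LinkDiagram V} {u v : V} (h : D.Bigon u v) :
    ∃ d e : V × ZMod 4, d.1 = u ∧ (D.opp (turn 2 d)).1 = v ∧ (D.opp (turn 3 d)).1 = v ∧
      e.1 = v ∧ (D.opp (turn 2 e)).1 = u ∧ (D.opp (turn 3 e)).1 = u := by
  obtain ⟨-, i, j, h1, h2⟩ := h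
  have t : ∀ (w : V) (k l m : ZMod 4), k + l = m → turn l (w, k) = (w, m) :=
    fun w k l m hm => by rw [← hm]; rfl
  have s1 : ∀ k : ZMod 4, k + 2 + 2 = k ∧ k + 2 + 3 = k + 1 ∧ k + 1 + 2 = k - 1 ∧ k + 1 + 3 = k := by
    decide
  have e1 : turn 2 (u, i + 2) = (u, i) := t _ _ _ _ (s1 i).1
  have e2 : turn 3 (u, i + 2) = (u, i + 1) := t _ _ _ _ (s1 i).2.1
  have e3 : turn 2 (v, j + 1) = (v, j - 1) := t _ _ _ _ (s1 j).2.2.1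
  have e4 : turn 3 (v, j + 1) = (v, j) := t _ _ _ _ (s1 j).2.2.2
  -- The bigon occupies the darts `i`, `i + 1` at `u` and `j - 1`, `j` at `v`. These starting darts
  -- put it at positions 2 and 3, leaving positions 0 and 1 as the outer darts.
  refine ⟨(u, i + 2), (v, j + 1), rfl, ?_, ?_, rfl, ?_, ?_⟩
  · rw [e1, h1]
  · rw [e2, h2]
  · rw [e3, ← h2, D.opp_opp]
  · rw [e4, ← h1, D.opp_opp]

theorem Bigon.symm {D : LinkDiagram V} {u v : V} (h : D.Bigon u v) : D.Bigon v u := by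
  obtain ⟨hne, i, j, h1, h2⟩ := h
  refine ⟨hne.symm, j - 1, i + 1, ?_, ?_⟩
  · rw [← h2, D.opp_opp]
  · rw [sub_add_cancel, ← h1, D.opp_opp, add_sub_cancel_right]

/-- A crossing of a group of two or more crossings is a corner of a two-sided face. -/
theorem IsGroup.exists_bigon {D : LinkDiagram V} {G : Finset V} (hG : D.IsGroup G) {g : V}
    (hg : g ∈ G) (hne : G ≠ {g}) : ∃ u ∈ G, D.Bigon g u := by
  obtain ⟨v, hv⟩ := hG
  by_contra hno
  have hno' : ∀ u, ¬ D.Bigon g u := fun u hu =>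
    hno ⟨u, (hv u).2 (((hv g).1 hg).trans _ _ _ (.rel _ _ hu)), hu⟩
  -- A crossing on no bigon is alone in its class: being equal to `g` is invariant along every
  -- chain.
  have key : ∀ a b, Relation.EqvGen D.Bigon a b → (a = g ↔ b = g) := by
    intro a b h
    induction h with
    | rel a b h =>
      constructor
      · rintro rfl; exact absurd h (hno' _)
      · rintro rfl; exact absurd h.symm (hno' _)
    | refl a => rfl
    | symm a b _ ih => exact ih.symm
    | trans a b c _ _ ih1 ih2 => exact ih1.trans ih2
  apply hne
  ext w
  rw [Finset.mem_singleton]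
  constructor
  · intro hw
    exact (key g w ((((hv g).1 hg).symm _ _).trans _ _ _ ((hv w).1 hw))).1 rfl
  · rintro rfl; exact hg

/-- A group of two crossings consists of the corners of a two-sided face. -/
theorem IsGroup.bigon_of_pair {D : LinkDiagram V} [DecidableEq V] {a b : V} (hab : a ≠ b)
    (hG : D.IsGroup {a, b}) : D.Bigon a b := by
  obtain ⟨u, hu, hbig⟩ := hG.exists_bigon (g := a) (by simp) (by
    intro h
    have : b ∈ ({a, b} : Finset V) := by simp
    rw [h, Finset.mem_singleton] at this
    exact hab this.symm)
  rcases Finset.mem_insert.1 hu with rfl | hu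
  · exact absurd rfl hbig.1
  · rw [Finset.mem_singleton] at hu
    exact hu ▸ hbig

end Darts

/-! ### Counting incident arcs; connectedness and primeness. -/

section Counting

variable {V : Type*} [Fintype V] [DecidableEq V] (D : LinkDiagram V)

theorem mem_boundary {T : Finset V} {d : V × ZMod 4} :
    d ∈ D.boundary T ↔ d.1 ∈ T ∧ (D.opp d).1 ∉ T := by
  simp [boundary]

/-- The darts at crossings of `A` on the arcs from `A` to `B`. -/
def link (A B : Finset V) : Finset (V × ZMod 4) :=
  Finset.univ.filter fun d => d.1 ∈ A ∧ (D.opp d).1 ∈ B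

theorem mem_link {A B : Finset V} {d : V × ZMod 4} :
    d ∈ D.link A B ↔ d.1 ∈ A ∧ (D.opp d).1 ∈ B := by
  simp [link]

theorem card_link_comm (A B : Finset V) : (D.link A B).card = (D.link B A).card := by
  apply Finset.card_bij' (fun d _ => D.opp d) (fun d _ => D.opp d) <;>
    simp +contextual [mem_link, D.opp_opp]

/-- An arc between `A` and `B` is incident to each of them but not to their union, hence the factor
2. This is the source of all later bounds on incident arcs. -/
theorem card_boundary_union {A B : Finset V} (h : Disjoint A B) :
    (D.boundary (A ∪ B)).card + 2 * (D.link A B).card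
      = (D.boundary A).card + (D.boundary B).card := by
  have hAB : ∀ v, v ∈ A → v ∉ B := fun v hv => Finset.disjoint_left.1 h hv
  have e : D.boundary (A ∪ B) = (D.boundary A \ D.link A B) ∪ (D.boundary B \ D.link B A) := by
    ext d
    simp only [mem_boundary, mem_link, Finset.mem_union, Finset.mem_sdiff]
    tauto
  have hd : Disjoint (D.boundary A \ D.link A B) (D.boundary B \ D.link B A) := by
    rw [Finset.disjoint_left]
    simp only [mem_boundary, Finset.mem_sdiff]
    intro d h1 h2
    exact hAB _ h1.1.1 h2.1.1
  have s1 : D.link A B ⊆ D.boundary A := fun d hd => by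
    rw [mem_link] at hd
    exact (D.mem_boundary).2 ⟨hd.1, fun h' => hAB _ h' hd.2⟩
  have s2 : D.link B A ⊆ D.boundary B := fun d hd => by
    rw [mem_link] at hd
    exact (D.mem_boundary).2 ⟨hd.1, hAB _ hd.2⟩
  rw [e, Finset.card_union_of_disjoint hd]
  have c1 := Finset.card_sdiff_add_card_eq_card s1
  have c2 := Finset.card_sdiff_add_card_eq_card s2
  have c3 := D.card_link_comm A B
  omega

theorem card_darts (T : Finset V) :
    (D.link T T).card + (D.boundary T).card = 4 * T.card := by
  have hd : Disjoint (D.link T T) (D.boundary T) := by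
    rw [Finset.disjoint_left]
    simp only [mem_boundary, mem_link]
    tauto
  rw [← Finset.card_union_of_disjoint hd]
  have : D.link T T ∪ D.boundary T = T ×ˢ Finset.univ := by
    ext d
    simp only [mem_boundary, mem_link, Finset.mem_union, Finset.mem_product, Finset.mem_univ]
    tauto
  rw [this, Finset.card_product, Finset.card_univ, ZMod.card, mul_comm]

/-- Of the `4 * T.card` darts at `T`, those on inner arcs are paired off by the fixed-point-free
involution `opp`. -/
theorem even_card_boundary (T : Finset V) : Even (D.boundary T).card := by
  have h : Even (D.link T T).card := by
    rw [← ZMod.natCast_eq_zero_iff_even, Finset.card_eq_sum_ones, Nat.cast_sum]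
    refine Finset.sum_involution (fun d _ => D.opp d) ?_ ?_ ?_ ?_
    · intro d _; decide
    · intro d _ _; exact D.opp_ne d
    · intro d hd
      rw [mem_link] at hd ⊢
      rw [D.opp_opp]
      exact hd.symm
    · intro d _; exact D.opp_opp d
  have h2 : Even (4 * T.card) := ⟨2 * T.card, by ring⟩
  rw [← D.card_darts T, Nat.even_add] at h2
  exact h2.1 h

/-- A knot diagram is connected. -/
theorem IsKnot.boundary_nonempty {D : LinkDiagram V} (hK : D.IsKnot) {T : Finset V} {u v : V}
    (hu : u ∈ T) (hv : v ∉ T) : (D.boundary T).card ≠ 0 := by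
  intro h0
  rw [Finset.card_eq_zero] at h0
  have hopp : ∀ d, d.1 ∈ T → (D.opp d).1 ∈ T := fun d hd => by
    by_contra h
    have := (D.mem_boundary).2 ⟨hd, h⟩
    rw [h0] at this
    simp at this
  have hpow : ∀ (n : ℕ) d, d.1 ∈ T → ((D.straight ^ n) d).1 ∈ T := by
    intro n
    induction n with
    | zero => intro d hd; simpa using hd
    | succ n ih =>
      intro d hd
      rw [pow_succ']
      exact hopp _ (ih d hd)
  have hcyc : ∀ e, D.straight.SameCycle (u, 0) e → e.1 ∈ T := by
    intro e he
    -- There are finitely many darts, so a cycle is exhausted by nonnegative powers and closure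
    -- under forward steps suffices.
    obtain ⟨n, -, rfl⟩ := he.exists_pow_eq'
    exact hpow n _ hu
  rcases hK.2 (u, 0) (v, 0) with h | h
  · exact hv (hcyc _ h)
  · have := hopp _ (hcyc _ h)
    rw [D.opp_opp] at this
    exact hv this

/-- Incident arcs of a tangle with crossings inside and outside it: at least four. -/
theorem IsPrimeAlternatingKnot.four_le_card_boundary {D : LinkDiagram V}
    (hK : D.IsPrimeAlternatingKnot) {T : Finset V} {u v : V} (hu : u ∈ T) (hv : v ∉ T) :
    4 ≤ (D.boundary T).card := by
  have h0 := hK.knot.boundary_nonempty hu hv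
  have h2 := hK.prime T
  obtain ⟨m, hm⟩ := D.even_card_boundary T
  omega

end Counting

/-! ### Triangles in OTS tangles. -/

section Triangle

variable {V : Type*} [Fintype V] [DecidableEq V] {D : LinkDiagram V}

/-- The corner of an OTS tangle at one of its crossings. -/
theorem IsOTSTangle.exists_corner {T : Finset V} (hT : D.IsOTSTangle T) {c : V} (hc : c ∈ T) :
    ∃ d, d.1 = c ∧ D.face (D.face (D.face d)) = d ∧
      T = {d.1, (D.face d).1, (D.face (D.face d)).1} := by
  obtain ⟨-, -, d, hd, hTd⟩ := hT
  have hc' := hc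
  rw [hTd] at hc'
  simp only [Finset.mem_insert, Finset.mem_singleton] at hc'
  rcases hc' with h | h | h
  · exact ⟨d, h.symm, hd, hTd⟩
  · refine ⟨D.face d, h.symm, by rw [hd], ?_⟩
    rw [hTd, hd]
    ext v; simp only [Finset.mem_insert, Finset.mem_singleton]; tauto
  · refine ⟨D.face (D.face d), h.symm, by rw [hd], ?_⟩
    rw [hTd, hd]
    ext v; simp only [Finset.mem_insert, Finset.mem_singleton]; tauto

/-- Two crossings of an OTS tangle are joined by only one arc. -/
theorem IsOTSTangle.dart_unique {T : Finset V} (hT : D.IsOTSTangle T) {α β : V × ZMod 4}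
    (hα : α.1 ∈ T) (hβ : β.1 = α.1) (hα' : (D.opp α).1 ∈ T)
    (hβ' : (D.opp β).1 = (D.opp α).1) : α = β := by
  obtain ⟨d, hdα, hd, hTd⟩ := hT.exists_corner hα
  have hcard := hT.1
  have hb := hT.2.1
  set f := D.face d with hf
  set g := D.face f with hg
  have hne : d.1 ≠ f.1 ∧ d.1 ≠ g.1 ∧ f.1 ≠ g.1 := by
    rw [hTd] at hcard
    refine ⟨fun h => ?_, fun h => ?_, fun h => ?_⟩ <;> rw [h] at hcard
    · have := Finset.card_le_two (a := f.1) (b := g.1)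
      simp at hcard; omega
    · have := Finset.card_le_two (a := f.1) (b := g.1)
      rw [Finset.insert_comm] at hcard
      simp at hcard
      omega
    · have := Finset.card_le_two (a := d.1) (b := g.1)
      simp at hcard; omega
  obtain ⟨hdf, hdg, hfg⟩ := hne
  have od : D.opp d = turn 1 f := (D.turn_one_face d).symm
  have of : D.opp f = turn 1 g := (D.turn_one_face f).symm
  have og : D.opp g = turn 1 d := by rw [← D.turn_one_face g, hd]
  have od' : D.opp (turn 1 f) = d := by rw [← od, D.opp_opp]
  have of' : D.opp (turn 1 g) = f := by rw [← of, D.opp_opp]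
  have og' : D.opp (turn 1 d) = g := by rw [← og, D.opp_opp]
  have mT : d.1 ∈ T ∧ f.1 ∈ T ∧ g.1 ∈ T := by rw [hTd]; simp
  obtain ⟨md, mf, mg⟩ := mT
  -- Of the twelve darts at `T`, six lie on incident arcs. The six darts on the sides of the
  -- triangle are thus all that remain, so every inner arc is a side.
  let S : Finset (V × ZMod 4) := {d, turn 1 d, f, turn 1 f, g, turn 1 g}
  have hS : S ⊆ D.link T T := by
    intro e he
    simp only [S, Finset.mem_insert, Finset.mem_singleton] at he
    rw [mem_link]
    rcases he with rfl | rfl | rfl | rfl | rfl | rfl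
    · rw [od]; exact ⟨md, mf⟩
    · rw [og']; exact ⟨md, mg⟩
    · rw [of]; exact ⟨mf, mg⟩
    · rw [od']; exact ⟨mf, md⟩
    · rw [og]; exact ⟨mg, md⟩
    · rw [of']; exact ⟨mg, mf⟩
  have ne : ∀ {x y : V × ZMod 4}, x.1 ≠ y.1 → x ≠ y := fun h h' => h (congrArg Prod.fst h')
  have hScard : S.card = 6 := by
    have t1 := (turn_one_ne d).symm
    have t2 := (turn_one_ne f).symm
    have t3 := (turn_one_ne g).symm
    simp only [S]
    rw [Finset.card_insert_of_notMem, Finset.card_insert_of_notMem, Finset.card_insert_of_notMem,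
      Finset.card_insert_of_notMem, Finset.card_pair t3] <;>
    simp only [Finset.mem_insert, Finset.mem_singleton, not_or]
    · exact ⟨ne hfg, ne hfg⟩
    · exact ⟨t2, ne hfg, ne hfg⟩
    · exact ⟨ne hdf, ne hdf, ne hdg, ne hdg⟩
    · exact ⟨t1, ne hdf, ne hdf, ne hdg, ne hdg⟩
  have hlink : D.link T T = S := by
    symm
    apply Finset.eq_of_subset_of_card_le hS
    have := D.card_darts T
    rw [hT.1] at this
    omega
  have corner : ∀ e : V × ZMod 4, e.1 = d.1 → (D.opp e).1 ∈ T → e = d ∨ e = turn 1 d := by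
    intro e he he'
    have : e ∈ S := by rw [← hlink, mem_link, he]; exact ⟨md, he'⟩
    simp only [S, Finset.mem_insert, Finset.mem_singleton] at this
    rcases this with h | h | h | h | h | h
    · exact .inl h
    · exact .inr h
    all_goals
      exfalso
      rw [h] at he
      first | exact hdf he.symm | exact hdg he.symm
  have cf : (D.opp d).1 ≠ (D.opp (turn 1 d)).1 := by rw [od, og']; exact hfg
  rcases corner α hdα.symm hα' with h | h <;>
  rcases corner β (hβ.trans hdα.symm) (hβ' ▸ hα') with h' | h'
  · rw [h, h']
  · rw [h, h'] at hβ'; exact absurd hβ'.symm cf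
  · rw [h, h'] at hβ'; exact absurd hβ' cf
  · rw [h, h']

/-- The two other crossings of an OTS tangle, seen from its crossing `c`. -/
theorem IsOTSTangle.exists_neighbours {T : Finset V} (hT : D.IsOTSTangle T) {c : V} (hc : c ∈ T) :
    ∃ d, d.1 = c ∧ (D.opp d).1 ∈ T ∧ (D.opp (turn 1 d)).1 ∈ T ∧
      (D.opp d).1 ≠ (D.opp (turn 1 d)).1 ∧ (D.opp d).1 ≠ c ∧ (D.opp (turn 1 d)).1 ≠ c ∧
      ∃ γ, γ.1 = (D.opp d).1 ∧ (D.opp γ).1 = (D.opp (turn 1 d)).1 := by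
  obtain ⟨d, rfl, hd, hTd⟩ := hT.exists_corner hc
  have ho := opp_turn_one_of_face_three hd
  have h1 : (D.opp d).1 ∈ T := by rw [hTd, ← face_fst]; simp
  have h2 : (D.opp (turn 1 d)).1 ∈ T := by rw [ho, hTd]; simp
  have hcard := hT.1
  rw [hTd] at hcard
  -- The witness `D.face d` for `γ` lies on the side of the triangle opposite to `c`.
  refine ⟨d, rfl, h1, h2, ?_, ?_, ?_, D.face d, rfl, by rw [ho]; rfl⟩
  · intro h
    exact turn_one_ne d (hT.dart_unique (β := turn 1 d) hc rfl h1 h.symm).symm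
  · intro h
    rw [← face_fst] at h
    rw [h] at hcard
    have := Finset.card_le_two (a := d.1) (b := (D.face (D.face d)).1)
    rw [Finset.insert_idem] at hcard
    omega
  · intro h
    rw [ho] at h
    rw [h] at hcard
    have := Finset.card_le_two (a := (D.face d).1) (b := d.1)
    rw [Finset.insert_comm, Finset.pair_eq_singleton] at hcard
    omega

end Triangle

/-! ### Axes of a group, and near and far arcs of a min-tangle. -/

section Flypes

variable {V : Type*} [Fintype V] [DecidableEq V] {D : LinkDiagram V}

theorem IsAxis.mem {G : Finset V} {p q : V × ZMod 4} (h : D.IsAxis G p q) :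
    p ∈ D.boundary G ∧ turn 1 p ∈ D.boundary G ∧ q ∈ D.boundary G ∧ turn 1 q ∈ D.boundary G := by
  rw [h.2]; simp

theorem IsAxis.cases {G : Finset V} {p q d : V × ZMod 4} (h : D.IsAxis G p q)
    (hd : d ∈ D.boundary G) : d = p ∨ d = turn 1 p ∨ d = q ∨ d = turn 1 q := by
  rw [h.2] at hd; simpa using hd

theorem IsAxis.ne {G : Finset V} {p q : V × ZMod 4} (h : D.IsAxis G p q) :
    (q ≠ p ∧ q ≠ turn 1 p) ∧ (turn 1 q ≠ p ∧ turn 1 q ≠ turn 1 p) := by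
  have h4 : ({p, turn 1 p, q, turn 1 q} : Finset (V × ZMod 4)).card = 4 := by rw [← h.2]; exact h.1
  have h1 : ¬ (q = p ∨ q = turn 1 p) := fun hq => by
    have hs : ({p, turn 1 p, q, turn 1 q} : Finset (V × ZMod 4)) ⊆ {p, turn 1 p, turn 1 q} := by
      intro d; simp only [Finset.mem_insert, Finset.mem_singleton]
      rintro (h | h | h | h)
      · exact .inl h
      · exact .inr (.inl h)
      · rw [h]; tauto
      · exact .inr (.inr h)
    have := (Finset.card_le_card hs).trans Finset.card_le_three
    omega
  have h2 : ¬ (turn 1 q = p ∨ turn 1 q = turn 1 p) := fun hq => by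
    have hs : ({p, turn 1 p, q, turn 1 q} : Finset (V × ZMod 4)) ⊆ {p, turn 1 p, q} := by
      intro d; simp only [Finset.mem_insert, Finset.mem_singleton]
      rintro (h | h | h | h)
      · exact .inl h
      · exact .inr (.inl h)
      · exact .inr (.inr h)
      · rw [h]; tauto
    have := (Finset.card_le_card hs).trans Finset.card_le_three
    omega
  exact ⟨not_or.1 h1, not_or.1 h2⟩

/-- A group whose two ends are at the same crossing is a loner. -/
theorem IsAxis.isLoner {G : Finset V} {p q : V × ZMod 4} (h : D.IsAxis G p q) (hG : D.IsGroup G)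
    (hpq : q.1 = p.1) : D.IsLoner G := by
  refine ⟨hG, ?_⟩
  have hp := ((D.mem_boundary).1 h.mem.1).1
  suffices G = {p.1} by rw [this, Finset.card_singleton]
  by_contra hne
  obtain ⟨u, hu, -, i, j, h1, -⟩ := hG.exists_bigon hp hne
  have hsub : D.boundary G ⊆ ({p.1} : Finset V) ×ˢ (Finset.univ : Finset (ZMod 4)) := by
    intro d hd
    rw [Finset.mem_product, Finset.mem_singleton]
    refine ⟨?_, Finset.mem_univ _⟩
    rcases h.cases hd with e | e | e | e <;> rw [e]
    · rfl
    · exact hpq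
    · exact hpq
  -- All four darts at the crossing would be incident arcs of `G`, but one of them leads to the
  -- bigon partner `u` inside `G`.
  have heq := Finset.eq_of_subset_of_card_le hsub (by
    rw [h.1, Finset.card_product, Finset.card_univ, ZMod.card, Finset.card_singleton])
  have hm : (p.1, i) ∈ D.boundary G := by rw [heq]; simp
  rw [mem_boundary, h1] at hm
  exact hm.2 hu

theorem IsSegment.disjoint {G X : Finset V} {p : V × ZMod 4} (h : D.IsSegment G p X) :
    Disjoint X G := by
  rcases h with rfl | h
  · exact Finset.disjoint_empty_left _
  · exact h.1

/-- `X` and `Y` are consecutive among the tangles across which `G` can be flyped from its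
end `p`. -/
structure IsFlypeStep (D : LinkDiagram V) (G : Finset V) (p q : V × ZMod 4) (X Y : Finset V) :
    Prop where
  axis : D.IsAxis G p q
  left : D.IsSegment G p X
  right : D.IsSegment G p Y
  ssubset : X ⊂ Y
  consecutive : ∀ Z, D.IsSegment G p Z → X ⊆ Z → Z ⊆ Y → Z = X ∨ Z = Y

/-- The two incident arcs of `Y` other than those at the end `p` of the flyped group. -/
def farArcs (D : LinkDiagram V) (p : V × ZMod 4) (Y : Finset V) : Finset (V × ZMod 4) :=
  D.boundary Y \ {D.opp p, D.opp (turn 1 p)}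

theorem card_near {V : Type*} [DecidableEq V] (D : LinkDiagram V) (p : V × ZMod 4) :
    ({D.opp p, D.opp (turn 1 p)} : Finset (V × ZMod 4)).card = 2 :=
  Finset.card_pair fun h => turn_one_ne p (D.opp.injective h).symm

theorem mem_farArcs {p d : V × ZMod 4} {Y : Finset V} :
    d ∈ D.farArcs p Y ↔ d ∈ D.boundary Y ∧ d ≠ D.opp p ∧ d ≠ D.opp (turn 1 p) := by
  simp [farArcs]

namespace IsFlypeStep

variable {G X Y : Finset V} {p q : V × ZMod 4}

theorem right_spec (h : D.IsFlypeStep G p q X Y) : Disjoint Y G ∧ (D.boundary Y).card = 4 ∧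
    D.opp p ∈ D.boundary Y ∧ D.opp (turn 1 p) ∈ D.boundary Y := by
  rcases h.right with h0 | h0
  · exact absurd (h0 ▸ h.ssubset) (Finset.not_ssubset_empty X)
  · exact h0

theorem left_spec (h : D.IsFlypeStep G p q X Y) (hX : X ≠ ∅) : (D.boundary X).card = 4 ∧
    D.opp p ∈ D.boundary X ∧ D.opp (turn 1 p) ∈ D.boundary X :=
  (h.left.resolve_left hX).2

theorem card_farArcs (h : D.IsFlypeStep G p q X Y) : (D.farArcs p Y).card = 2 := by
  obtain ⟨-, h4, h1, h2⟩ := h.right_spec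
  have hs : ({D.opp p, D.opp (turn 1 p)} : Finset (V × ZMod 4)) ⊆ D.boundary Y := by
    intro d hd
    rcases Finset.mem_insert.1 hd with rfl | hd
    · exact h1
    · rw [Finset.mem_singleton.1 hd]; exact h2
  have := Finset.card_sdiff_add_card_eq_card hs
  rw [card_near, h4] at this
  exact Nat.add_right_cancel this

/-- The incident arcs of `X` lead to the min-tangle `Y \ X` or to the end `p` of `G`. -/
theorem boundary_left (h : D.IsFlypeStep G p q X Y) (hX : X ≠ ∅)
    (h4 : (D.boundary (Y \ X)).card = 4) {d : V × ZMod 4} (hd : d ∈ D.boundary X) :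
    d ∈ D.link X (Y \ X) ∨ d = D.opp p ∨ d = D.opp (turn 1 p) := by
  obtain ⟨hX4, h1, h2⟩ := h.left_spec hX
  -- Since `X`, `Y \ X` and `Y` all have four incident arcs, exactly two arcs join `X` to `Y \ X`.
  -- With the two arcs to the end `p` they exhaust the boundary of `X`.
  have hu := D.card_boundary_union (A := X) (B := Y \ X) Finset.disjoint_sdiff
  rw [Finset.union_sdiff_of_subset h.ssubset.1, h.right_spec.2.1, hX4, h4] at hu
  have hG : ∀ e ∈ D.boundary G, e.1 ∉ Y := fun e he hY =>
    Finset.disjoint_left.1 h.right_spec.1 hY ((D.mem_boundary).1 he).1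
  have hdis : Disjoint (D.link X (Y \ X)) {D.opp p, D.opp (turn 1 p)} := by
    rw [Finset.disjoint_left]
    intro e he he'
    rw [mem_link, Finset.mem_sdiff] at he
    rw [Finset.mem_insert, Finset.mem_singleton] at he'
    rcases he' with rfl | rfl <;> rw [D.opp_opp] at he
    · exact hG _ h.axis.mem.1 he.2.1
    · exact hG _ h.axis.mem.2.1 he.2.1
  have hs : D.link X (Y \ X) ∪ {D.opp p, D.opp (turn 1 p)} ⊆ D.boundary X := by
    intro e he
    rw [Finset.mem_union, mem_link, Finset.mem_sdiff, Finset.mem_insert,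
      Finset.mem_singleton] at he
    rcases he with he | rfl | rfl
    · exact (D.mem_boundary).2 ⟨he.1, he.2.2⟩
    · exact h1
    · exact h2
  have heq := Finset.eq_of_subset_of_card_le hs (by
    rw [Finset.card_union_of_disjoint hdis, card_near]; omega)
  rw [← heq, Finset.mem_union, Finset.mem_insert, Finset.mem_singleton] at hd
  exact hd

/-- A far arc starting in `X` would be incident to `X`, so by `boundary_left` it would lead into `Y`
or to the end `p`; a far arc does neither. -/
theorem farArcs_subset (h : D.IsFlypeStep G p q X Y) (h4 : (D.boundary (Y \ X)).card = 4) :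
    D.farArcs p Y ⊆ D.boundary (Y \ X) := by
  intro d hd
  obtain ⟨hdY, hd1, hd2⟩ := mem_farArcs.1 hd
  rw [mem_boundary] at hdY
  rw [mem_boundary, Finset.mem_sdiff, Finset.mem_sdiff]
  refine ⟨⟨hdY.1, fun hdX => ?_⟩, fun h' => hdY.2 h'.1⟩
  have hX : X ≠ ∅ := Finset.ne_empty_of_mem hdX
  rcases h.boundary_left hX h4 ((D.mem_boundary).2 ⟨hdX, fun h' => hdY.2 (h.ssubset.1 h')⟩) with
    h' | h' | h'
  · rw [mem_link, Finset.mem_sdiff] at h'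
    exact hdY.2 h'.2.1
  · exact hd1 h'
  · exact hd2 h'

/-- The incident arcs of the min-tangle `Y \ X` other than the far arcs of `Y` lead to the end `p`
of `G` or to `X`. -/
theorem near_cases (h : D.IsFlypeStep G p q X Y) {d : V × ZMod 4}
    (hd : d ∈ D.boundary (Y \ X)) (hd' : d ∉ D.farArcs p Y) :
    (X = ∅ ∧ (d = D.opp p ∨ d = D.opp (turn 1 p))) ∨ (X ≠ ∅ ∧ (D.opp d).1 ∈ X) := by
  rw [mem_farArcs] at hd'
  by_cases hX : X = ∅
  · refine .inl ⟨hX, ?_⟩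
    rw [hX, Finset.sdiff_empty] at hd
    tauto
  · refine .inr ⟨hX, ?_⟩
    obtain ⟨-, h1, h2⟩ := h.left_spec hX
    rw [mem_boundary, Finset.mem_sdiff, Finset.mem_sdiff] at hd
    by_contra hn
    refine hd' ⟨(D.mem_boundary).2 ⟨hd.1.1, fun hY => hd.2 ⟨hY, hn⟩⟩, ?_, ?_⟩
    · rintro rfl; exact hd.1.2 ((D.mem_boundary).1 h1).1
    · rintro rfl; exact hd.1.2 ((D.mem_boundary).1 h2).1

/-- In a min-tangle that consists of two crossings, the two outer arcs at one crossing are not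
both on the near side. -/
theorem not_both_near (h : D.IsFlypeStep G p q X Y) {v w : V} (hv : v ∈ Y \ X) (hw : w ∈ Y \ X)
    (hvw : w ≠ v) {d : V × ZMod 4} (hdv : d.1 = v) (h2 : (D.opp (turn 2 d)).1 = w)
    (h3 : (D.opp (turn 3 d)).1 = w) (hb0 : d ∈ D.boundary (Y \ X))
    (hb1 : turn 1 d ∈ D.boundary (Y \ X)) (hn0 : d ∉ D.farArcs p Y)
    (hn1 : turn 1 d ∉ D.farArcs p Y) : False := by
  have hv' := Finset.mem_sdiff.1 hv
  have hw' := Finset.mem_sdiff.1 hw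
  have hnot : ∀ e ∈ D.boundary (Y \ X), (D.opp e).1 ≠ v := fun e he hev =>
    ((D.mem_boundary).1 he).2 (hev ▸ hv)
  -- There is no loop at `v`, so all four of its darts are incident arcs of `{v}`.
  have hall : ∀ e : V × ZMod 4, e.1 = v → (D.opp e).1 ≠ v := by
    intro e he
    rcases dart_cases (he.trans hdv.symm) with rfl | rfl | rfl | rfl
    · exact hnot _ hb0
    · exact hnot _ hb1
    · rw [h2]; exact hvw
    · rw [h3]; exact hvw
  have hbv : ∀ e : V × ZMod 4, e ∈ D.boundary {v} ↔ e.1 = v := fun e => by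
    rw [mem_boundary, Finset.mem_singleton, Finset.mem_singleton]
    exact ⟨fun h => h.1, fun h => ⟨h, hall e h⟩⟩
  have hbv4 : (D.boundary {v}).card = 4 := by
    have : D.boundary {v} = ({v} : Finset V) ×ˢ (Finset.univ : Finset (ZMod 4)) := by
      ext e; rw [hbv, Finset.mem_product, Finset.mem_singleton]; simp
    rw [this, Finset.card_product, Finset.card_univ, ZMod.card, Finset.card_singleton]
  have hdis : Disjoint (insert v X) G := by
    rw [Finset.disjoint_insert_left]
    exact ⟨Finset.disjoint_left.1 h.right_spec.1 hv'.1, h.left.disjoint⟩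
  have hmem : ∀ e ∈ D.boundary G, (D.opp e).1 ∈ insert v X →
      D.opp e ∈ D.boundary (insert v X) := fun e he hi => by
    rw [mem_boundary, D.opp_opp]
    exact ⟨hi, fun h' => Finset.disjoint_left.1 hdis h' ((D.mem_boundary).1 he).1⟩
  -- Two near arcs at `v` make `insert v X` an intermediate tangle, contradicting consecutiveness:
  -- it contains `v`, but not `w`.
  have key : D.IsSegment G p (insert v X) := by
    by_cases hX : X = ∅
    · have c0 := (h.near_cases hb0 hn0).resolve_right (fun h' => h'.1 hX)
      have c1 := (h.near_cases hb1 hn1).resolve_right (fun h' => h'.1 hX)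
      have hends : (D.opp p).1 = v ∧ (D.opp (turn 1 p)).1 = v := by
        have hd1 : (turn 1 d).1 = v := hdv
        rcases c0.2 with e0 | e0 <;> rcases c1.2 with e1 | e1
        · exact absurd (e1.trans e0.symm) (turn_one_ne d)
        · rw [← e0, ← e1]; exact ⟨hdv, hd1⟩
        · rw [← e0, ← e1]; exact ⟨hd1, hdv⟩
        · exact absurd (e1.trans e0.symm) (turn_one_ne d)
      refine .inr ⟨hdis, ?_, hmem _ h.axis.mem.1 (by simp [hends.1]),
        hmem _ h.axis.mem.2.1 (by simp [hends.2])⟩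
      rw [hX]
      exact hbv4
    · obtain ⟨hX4, m1, m2⟩ := h.left_spec hX
      have c0 := ((h.near_cases hb0 hn0).resolve_left (fun h' => hX h'.1)).2
      have c1 := ((h.near_cases hb1 hn1).resolve_left (fun h' => hX h'.1)).2
      refine .inr ⟨hdis, ?_, hmem _ h.axis.mem.1
        (Finset.mem_insert_of_mem ((D.mem_boundary).1 m1).1), hmem _ h.axis.mem.2.1
        (Finset.mem_insert_of_mem ((D.mem_boundary).1 m2).1)⟩
      have hl : D.link {v} X = {d, turn 1 d} := by
        ext e
        rw [mem_link, Finset.mem_singleton, Finset.mem_insert, Finset.mem_singleton]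
        constructor
        · rintro ⟨he, heX⟩
          rcases dart_cases (he.trans hdv.symm) with r | r | r | r
          · exact .inl r
          · exact .inr r
          · rw [r, h2] at heX; exact absurd heX hw'.2
          · rw [r, h3] at heX; exact absurd heX hw'.2
        · rintro (rfl | rfl)
          · exact ⟨hdv, c0⟩
          · exact ⟨hdv, c1⟩
      -- Exactly two arcs join `v` to `X`, so the union has 4 + 4 - 2 * 2 = 4 incident arcs.
      have hu := D.card_boundary_union (A := {v}) (B := X) (Finset.disjoint_singleton_left.2 hv'.2)
      rw [hl, Finset.card_pair (turn_one_ne d).symm, hbv4, hX4] at hu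
      rw [Finset.insert_eq]
      omega
  have hsub : insert v X ⊆ Y := Finset.insert_subset hv'.1 h.ssubset.1
  rcases h.consecutive _ key (Finset.subset_insert v X) hsub with e | e
  · exact hv'.2 (e ▸ Finset.mem_insert_self v X)
  · have := hw'.1
    rw [← e, Finset.mem_insert] at this
    exact this.elim hvw (Finset.mem_sdiff.1 hw).2

/-- If a min-tangle consists of the two corners of a two-sided face, then one of the outer arcs at
each corner is a far arc and the other one is not. -/
theorem far_iff_of_bigon (h : D.IsFlypeStep G p q X Y) (hK : D.IsPrimeAlternatingKnot) {a b : V}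
    (hab : a ≠ b) (hYX : Y \ X = {a, b}) {d e : V × ZMod 4} (hd : d.1 = a)
    (hd2 : (D.opp (turn 2 d)).1 = b) (hd3 : (D.opp (turn 3 d)).1 = b) (he : e.1 = b)
    (he2 : (D.opp (turn 2 e)).1 = a) (he3 : (D.opp (turn 3 e)).1 = a) :
    (D.boundary (Y \ X)).card = 4 ∧ (d ∈ D.farArcs p Y ↔ turn 1 d ∉ D.farArcs p Y) := by
  have ha : a ∈ Y \ X := by rw [hYX]; simp
  have hb : b ∈ Y \ X := by rw [hYX]; simp
  have hp : p.1 ∉ Y \ X := fun hp => Finset.disjoint_left.1 h.right_spec.1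
    (Finset.mem_sdiff.1 hp).1 ((D.mem_boundary).1 h.axis.mem.1).1
  have h4le := hK.four_le_card_boundary ha hp
  -- The bigon leaves at most four outer darts, and `h4le` requires at least four; so all of them
  -- are incident arcs.
  have hsub : D.boundary (Y \ X) ⊆ {d, turn 1 d, e, turn 1 e} := by
    intro f hf
    have hf' := (D.mem_boundary).1 hf
    simp only [Finset.mem_insert, Finset.mem_singleton]
    have hfab : f.1 = a ∨ f.1 = b := by simpa [hYX] using hf'.1
    rcases hfab with hfa | hfb
    · rcases dart_cases (hfa.trans hd.symm) with r | r | r | r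
      · exact .inl r
      · exact .inr (.inl r)
      · rw [r, hd2] at hf'; exact absurd hb hf'.2
      · rw [r, hd3] at hf'; exact absurd hb hf'.2
    · rcases dart_cases (hfb.trans he.symm) with r | r | r | r
      · exact .inr (.inr (.inl r))
      · exact .inr (.inr (.inr r))
      · rw [r, he2] at hf'; exact absurd ha hf'.2
      · rw [r, he3] at hf'; exact absurd ha hf'.2
  have heq := Finset.eq_of_subset_of_card_le hsub (Finset.card_le_four.trans h4le)
  have h4 : (D.boundary (Y \ X)).card = 4 :=
    le_antisymm ((Finset.card_le_card hsub).trans Finset.card_le_four) h4le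
  have m : d ∈ D.boundary (Y \ X) ∧ turn 1 d ∈ D.boundary (Y \ X) ∧ e ∈ D.boundary (Y \ X) ∧
      turn 1 e ∈ D.boundary (Y \ X) := by rw [heq]; simp
  obtain ⟨m1, m2, m3, m4⟩ := m
  refine ⟨h4, fun f1 f2 => ?_, fun f2 => ?_⟩
  · have hs : ({d, turn 1 d} : Finset (V × ZMod 4)) ⊆ D.farArcs p Y := by
      intro f hf
      rcases Finset.mem_insert.1 hf with rfl | hf
      · exact f1
      · rw [Finset.mem_singleton.1 hf]; exact f2
    -- There are only two far arcs. If both were at `a`, both outer arcs at `b` would be near.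
    have hfar := Finset.eq_of_subset_of_card_le hs (by
      rw [h.card_farArcs, Finset.card_pair (turn_one_ne d).symm])
    have hno : ∀ f : V × ZMod 4, f.1 = b → f ∉ D.farArcs p Y := by
      intro f hf hf'
      rw [← hfar, Finset.mem_insert, Finset.mem_singleton] at hf'
      rcases hf' with rfl | rfl
      · exact hab (hd.symm.trans hf)
      · exact hab (hd.symm.trans hf)
    exact h.not_both_near hb ha hab he he2 he3 m3 m4 (hno _ he) (hno _ he)
  · by_contra f1
    exact h.not_both_near ha hb hab.symm hd hd2 hd3 m1 m2 f1 f2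

/-- If some crossing lies outside `Y` and `G`, then the far arcs of `Y` do not lead to `G`. -/
theorem far_not_mem_group (h : D.IsFlypeStep G p q X Y) (hK : D.IsPrimeAlternatingKnot) {w : V}
    (hw : w ∉ Y ∪ G) {r : V × ZMod 4} (hr : r ∈ D.farArcs p Y) : (D.opp r).1 ∉ G := by
  intro hrG
  obtain ⟨hYG, hY4, h1, h2⟩ := h.right_spec
  have hpG := (D.mem_boundary).1 h.axis.mem.1
  have h4 := hK.four_le_card_boundary (Finset.mem_union_right Y hpG.1) hw
  have hu := D.card_boundary_union hYG
  -- With 4 + 4 incident arcs, and at least 4 left for the union, at most two arcs join `Y` to `G`.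
  -- The end `p` already supplies two, so a far arc leading to `G` would be a third.
  rw [hY4, h.axis.1] at hu
  obtain ⟨hrY, hr1, hr2⟩ := mem_farArcs.1 hr
  have hs : insert r ({D.opp p, D.opp (turn 1 p)} : Finset (V × ZMod 4)) ⊆ D.link Y G := by
    intro f hf
    simp only [Finset.mem_insert, Finset.mem_singleton] at hf
    rw [mem_link]
    rcases hf with rfl | rfl | rfl
    · exact ⟨((D.mem_boundary).1 hrY).1, hrG⟩
    · rw [D.opp_opp]; exact ⟨((D.mem_boundary).1 h1).1, hpG.1⟩
    · rw [D.opp_opp]; exact ⟨((D.mem_boundary).1 h2).1, hpG.1⟩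
  have hc := Finset.card_le_card hs
  rw [Finset.card_insert_of_notMem (by simp [hr1, hr2]), card_near] at hc
  omega

/-- If `Y` and `G` are the whole diagram, then the end `q` of `G` leads to the far arcs of `Y`. -/
theorem far_of_cover (h : D.IsFlypeStep G p q X Y) (hcov : ∀ v, v ∈ Y ∪ G) :
    D.opp q ∈ D.farArcs p Y ∧ D.opp (turn 1 q) ∈ D.farArcs p Y := by
  have key : ∀ e ∈ D.boundary G, e ≠ p → e ≠ turn 1 p → D.opp e ∈ D.farArcs p Y := by
    intro e he h1 h2
    have he' := (D.mem_boundary).1 he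
    refine mem_farArcs.2 ⟨(D.mem_boundary).2 ⟨?_, ?_⟩, fun h' => h1 (D.opp.injective h'),
      fun h' => h2 (D.opp.injective h')⟩
    · exact (Finset.mem_union.1 (hcov _)).resolve_right he'.2
    · rw [D.opp_opp]
      exact fun hY => Finset.disjoint_left.1 h.right_spec.1 hY he'.1
  obtain ⟨-, -, m1, m2⟩ := h.axis.mem
  obtain ⟨⟨n1, n2⟩, n3, n4⟩ := h.axis.ne
  exact ⟨key q m1 n1 n2, key _ m2 n3 n4⟩

/-- If `Y` and `G` are the whole diagram, then the far arcs of `Y` lead to the end `q` of `G`. -/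
theorem far_cases_of_cover (h : D.IsFlypeStep G p q X Y) (hcov : ∀ v, v ∈ Y ∪ G)
    {r : V × ZMod 4} (hr : r ∈ D.farArcs p Y) : (D.opp r).1 = q.1 := by
  obtain ⟨hrY, hr1, hr2⟩ := mem_farArcs.1 hr
  rw [mem_boundary] at hrY
  have hm : D.opp r ∈ D.boundary G := by
    rw [mem_boundary, D.opp_opp]
    exact ⟨(Finset.mem_union.1 (hcov _)).resolve_left hrY.2,
      Finset.disjoint_left.1 h.right_spec.1 hrY.1⟩
  rcases h.axis.cases hm with e | e | e | e
  · exact absurd (by rw [← e, D.opp_opp]) hr1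
  · exact absurd (by rw [← e, D.opp_opp]) hr2
  · rw [e]
  · rw [e]; rfl

end IsFlypeStep

/-! ### The triangle at the min-tangle: where its third side can run. -/

/-- An arc between the two ends of a group with at least two crossings is one of two parallel
arcs, so that the ends of the group are not both in an OTS tangle that contains this arc. -/
theorem IsAxis.not_ots {G T : Finset V} {p q : V × ZMod 4} (h : D.IsAxis G p q)
    (hG : D.IsGroup G) (hT : D.IsOTSTangle T) (hpq : p.1 ≠ q.1) (hpT : p.1 ∈ T) (hqT : q.1 ∈ T)
    {γ : V × ZMod 4} (hγ : γ.1 = p.1) (hγ' : (D.opp γ).1 = q.1) : False := by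
  obtain ⟨mp, mp', mq, -⟩ := h.mem
  have hp := ((D.mem_boundary).1 mp).1
  have hq := ((D.mem_boundary).1 mq).1
  obtain ⟨u, hu, -, i, j, h1, h2⟩ := hG.exists_bigon hp (by
    intro he
    rw [he, Finset.mem_singleton] at hq
    exact hpq hq.symm)
  -- Only two darts at `p.1` can lead into `G`. The bigon with `u` uses both, so `γ` is one of its
  -- two sides and `u` is `q.1`.
  have inner : ∀ f : V × ZMod 4, f.1 = p.1 → (D.opp f).1 ∈ G → f = turn 2 p ∨ f = turn 3 p := by
    intro f hf hf'
    rcases dart_cases hf with rfl | rfl | r | r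
    · exact absurd hf' ((D.mem_boundary).1 mp).2
    · exact absurd hf' ((D.mem_boundary).1 mp').2
    · exact .inl r
    · exact .inr r
  have hne : ((p.1, i) : V × ZMod 4) ≠ (p.1, i + 1) := fun he =>
    turn_one_ne (p.1, i) he.symm
  have hγu : γ = (p.1, i) ∨ γ = (p.1, i + 1) := by
    rcases inner γ hγ (hγ' ▸ hq) with a | a <;>
    rcases inner (p.1, i) rfl (by rw [h1]; exact hu) with b | b <;>
    rcases inner (p.1, i + 1) rfl (by rw [h2]; exact hu) with c | c <;>
    first
      | exact absurd (b.trans c.symm) hne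
      | exact .inl (a.trans b.symm)
      | exact .inr (a.trans c.symm)
  have huq : u = q.1 := by
    rw [← hγ']
    rcases hγu with r | r
    · rw [r, h1]
    · rw [r, h2]
  exact hne (hT.dart_unique (α := (p.1, i)) (β := (p.1, i + 1)) hpT rfl
    (by rw [h1, huq]; exact hqT) (by rw [h1, h2]))

/-- The conclusion for a given near arc `l` and far arc `r` of the min-tangle which are sides of
the three-sided face. -/
theorem IsFlypeStep.isLoner_and_isAdjacent {G X Y T : Finset V} {p q : V × ZMod 4}
    (h : D.IsFlypeStep G p q X Y) (hK : D.IsPrimeAlternatingKnot) (hG : D.IsGroup G)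
    (h4 : (D.boundary (Y \ X)).card = 4) (hT : D.IsOTSTangle T) {l r γ : V × ZMod 4}
    (hl : l ∈ D.boundary (Y \ X)) (hl' : l ∉ D.farArcs p Y) (hr : r ∈ D.farArcs p Y)
    (hlT : (D.opp l).1 ∈ T) (hrT : (D.opp r).1 ∈ T) (hne : (D.opp l).1 ≠ (D.opp r).1)
    (hγ : γ.1 = (D.opp l).1) (hγ' : (D.opp γ).1 = (D.opp r).1) :
    D.IsLoner G ∧ D.IsAdjacent G (Y \ X) := by
  obtain ⟨mp, mp', mq, mq'⟩ := h.axis.mem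
  have hrY := ((D.mem_boundary).1 (mem_farArcs.1 hr).1).2
  have hsub := h.farArcs_subset h4
  obtain ⟨hYG, -, hpY, hpY'⟩ := h.right_spec
  have hfar : (∃ w, w ∉ Y ∪ G) ∨ ∀ v, v ∈ Y ∪ G := by
    by_cases hc : ∀ v, v ∈ Y ∪ G
    · exact .inr hc
    · exact .inl (not_forall.1 hc)
  rcases h.near_cases hl hl' with ⟨hX, hlp⟩ | ⟨hX, hlX⟩
  · have hlp' : (D.opp l).1 = p.1 := by
      rcases hlp with e | e <;> rw [e, D.opp_opp]
      rfl
    rcases hfar with ⟨w, hw⟩ | hcov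
    -- Here `γ` leaves `G` at the crossing of the end `p` and avoids `Y`. The arcs at the end `p`
    -- lead into `Y`, so `γ` belongs to the end `q`, which is thus at the same crossing.
    · have hrG := h.far_not_mem_group hK hw hr
      have hγG : γ ∈ D.boundary G := by
        rw [mem_boundary, hγ, hγ', hlp']
        exact ⟨((D.mem_boundary).1 mp).1, hrG⟩
      have hqp : q.1 = p.1 := by
        rcases h.axis.cases hγG with e | e | e | e
        · exact absurd ((D.mem_boundary).1 hpY).1 (by rw [← e, hγ']; exact hrY)
        · exact absurd ((D.mem_boundary).1 hpY').1 (by rw [← e, hγ']; exact hrY)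
        · rw [← hlp', ← hγ, e]
        · rw [← hlp', ← hγ, e]; rfl
      refine ⟨h.axis.isLoner hG hqp, p, ⟨mp, mp'⟩, ?_⟩
      rw [hX, Finset.sdiff_empty]
      exact ⟨((D.mem_boundary).1 hpY).1, ((D.mem_boundary).1 hpY').1⟩
    -- Here `γ` would join the distinct end crossings of `G`, where it has a parallel arc; this is
    -- impossible in an OTS tangle.
    · have hrq := h.far_cases_of_cover hcov hr
      rw [hlp', hrq] at hne
      exact (h.axis.not_ots hG hT hne (hlp' ▸ hlT) (hrq ▸ hrT) (hγ.trans hlp')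
        (hγ'.trans hrq)).elim
  -- Now `γ` runs from `X` to a crossing outside `Y`, so it can only be one of the arcs to the end
  -- `p`. Hence the far arc `r` leads to `G` as well, which requires `Y` and `G` to cover the
  -- diagram.
  · have hγX : γ ∈ D.boundary X := by
      rw [mem_boundary, hγ, hγ']
      exact ⟨hlX, fun h' => hrY (h.ssubset.1 h')⟩
    have hγp : (D.opp γ).1 = p.1 := by
      rcases h.boundary_left hX h4 hγX with e | e | e
      · rw [mem_link, Finset.mem_sdiff, hγ'] at e
        exact absurd e.2.1 hrY
      · rw [e, D.opp_opp]
      · rw [e, D.opp_opp]; rfl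
    rcases hfar with ⟨w, hw⟩ | hcov
    · refine absurd ?_ (h.far_not_mem_group hK hw hr)
      rw [← hγ', hγp]
      exact ((D.mem_boundary).1 mp).1
    -- The far arc `r` reaches the crossing of the end `q`, and `γ` shows that this is `p.1`. The
    -- end adjacent to the min-tangle is now `q`, whose arcs are the far arcs.
    · have hrq := h.far_cases_of_cover hcov hr
      obtain ⟨f1, f2⟩ := h.far_of_cover hcov
      exact ⟨h.axis.isLoner hG (by rw [← hrq, ← hγ', hγp]), q, ⟨mq, mq'⟩,
        ((D.mem_boundary).1 (hsub f1)).1, ((D.mem_boundary).1 (hsub f2)).1⟩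

/-- If a min-tangle consists of the two corners of a two-sided face and one of them is in an OTS
tangle, then the flyped group is a loner next to the min-tangle. -/
theorem IsFlypeStep.isLoner_and_isAdjacent_of_bigon {G X Y T : Finset V} {p q : V × ZMod 4}
    (h : D.IsFlypeStep G p q X Y) (hK : D.IsPrimeAlternatingKnot) (hG : D.IsGroup G)
    (hT : D.IsOTSTangle T) {a b : V} (hbig : D.Bigon a b) (hYX : Y \ X = {a, b}) (ha : a ∈ T) :
    D.IsLoner G ∧ D.IsAdjacent G (Y \ X) := by
  obtain ⟨d, e, hd, hd2, hd3, he, he2, he3⟩ := hbig.exists_outer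
  obtain ⟨h4, hiff⟩ := h.far_iff_of_bigon hK hbig.1 hYX hd hd2 hd3 he he2 he3
  have hbT : b ∉ T := by
    intro hbT
    have heq := hT.dart_unique (α := turn 2 d) (β := turn 3 d) (hd ▸ ha) rfl (hd2 ▸ hbT)
      (hd3.trans hd2.symm)
    have h2 : d.2 + 2 = d.2 + 3 := congrArg Prod.snd heq
    exact absurd (add_left_cancel h2) (by decide)
  obtain ⟨c, hc, n1, n2, hne, n3, n4, γ, hγ, hγ'⟩ := hT.exists_neighbours ha
  have out : ∀ v ∈ T, v ≠ a → v ∉ Y \ X := by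
    intro v hv hva hvY
    rw [hYX, Finset.mem_insert, Finset.mem_singleton] at hvY
    rcases hvY with h' | rfl
    · exact hva h'
    · exact hbT hv
  -- Any other corner at `a` uses a dart of the bigon and would put `b` into `T`.
  have hcd : c = d := by
    have t : ∀ k l m : ZMod 4, k + l = m → turn l (turn k d) = turn m d := by
      intro k l m hm
      ext
      · rfl
      · simp [← hm, add_assoc]
    rcases dart_cases (hc.trans hd.symm) with r | r | r | r
    · exact r
    · rw [r, t 1 1 2 (by decide), hd2] at n2
      exact absurd n2 hbT
    · rw [r, hd2] at n1
      exact absurd n1 hbT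
    · rw [r, hd3] at n1
      exact absurd n1 hbT
  subst hcd
  have haY : a ∈ Y \ X := by rw [hYX]; simp
  have b1 : c ∈ D.boundary (Y \ X) := (D.mem_boundary).2 ⟨hc ▸ haY, out _ n1 n3⟩
  have b2 : turn 1 c ∈ D.boundary (Y \ X) := (D.mem_boundary).2 ⟨hc ▸ haY, out _ n2 n4⟩
  by_cases hf : c ∈ D.farArcs p Y
  -- The third side is taken from the near arc to the far arc, so it is reversed when `c` itself is
  -- far.
  · exact h.isLoner_and_isAdjacent hK hG h4 hT b2 (hiff.1 hf) hf n2 n1 hne.symm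
      (γ := D.opp γ) hγ' (by rw [D.opp_opp, hγ])
  · have hf' : turn 1 c ∈ D.farArcs p Y := by
      by_contra h'
      exact hf (hiff.2 h')
    exact h.isLoner_and_isAdjacent hK hG h4 hT b1 hf hf' n1 n2 hne hγ hγ'

end Flypes

end LinkDiagram

theorem mainTheorem2 {V : Type*} [Fintype V] [DecidableEq V] (D : LinkDiagram V)
    (hK : D.IsPrimeAlternatingKnot) (hfull : D.IsFullGroupConfiguration)
    (GD : Finset V) (hGD : D.IsDrotsTwoGroup GD)
    (hOTS : ∃ T, D.IsOTSTangle T ∧ ∃ c ∈ GD, c ∈ T) :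
    ∀ G, D.IsOrbiter G GD → D.IsLoner G ∧ D.IsAdjacent G GD := by
  rintro G ⟨hG, p, q, hax, X, Y, hX, hY, hXY, hmin, rfl⟩
  obtain ⟨T, hT, c, hc, hcT⟩ := hOTS
  obtain ⟨hgrp, hcard, -⟩ := hGD
  have h : D.IsFlypeStep G p q X Y := ⟨hax, hX, hY, hXY, hmin⟩
  obtain ⟨a, b, hab, hYX⟩ := Finset.card_eq_two.1 hcard
  have hbig : D.Bigon a b := (hYX ▸ hgrp).bigon_of_pair hab
  rw [hYX, Finset.mem_insert, Finset.mem_singleton] at hc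
  rcases hc with rfl | rfl
  · exact h.isLoner_and_isAdjacent_of_bigon hK hG hT hbig hYX hcT
  · exact h.isLoner_and_isAdjacent_of_bigon hK hG hT hbig.symm
      (hYX.trans (Finset.pair_comm _ _)) hcT
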